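/- A \emph{prime ideal} of a commutative monoid $M$ is a subset $\mathfrak p\subset M$ (possibly empty) with $M\mathfrak p\subset\mathfrak p$ whose complement is a submonoid, and $M_{\mathfrak p}$ denotes the localization of $M$ at $M\setminus\mathfrak p$. The spectrum $\operatorname{Spec} M$ is the set of prime ideals of $M$ with the topology whose closed sets are the sets $\{\mathfrak p : a\subset \mathfrak p\}$ ($a\subset M$), together with the sheaf of commutative monoids whose sections over $U$ are the families $s(\mathfrak p)\in M_{\mathfrak p}$, $\mathfrak p\in U$, that are locally fractions. A \emph{monoidal scheme} is a topological space $X$ with a sheaf $\mathcal O_X$ of commutative monoids that is locally isomorphic to spectra of commutative monoids. It is \emph{noetherian} if $X$ has a finite open cover by open subspaces isomorphic to $\operatorname{Spec} A_i$, where each $A_i$ is a noetherian monoid, i.e. its congruences satisfy the ascending chain condition. It is \emph{torsion-free} if for every $x\in X$ the abelian group $\mathcal O_{X,x}^\times$ of invertible elements of the stalk $\mathcal O_{X,x}$ is torsion-free. \textbf{Lemma.} A noetherian monoidal scheme $X$ is torsion-free if and only if for every point $x\in X$ there is a polynomial $P_x\in\mathbb Q[T]$ such that, for every finite abelian group $G$,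 the set $\operatorname{Hom}(\mathcal O_{X,x}^\times, G)$ is finite and $$\#\operatorname{Hom}(\mathcal O_{X,x}^\times, G)=P_x(\# G).$$ The same equivalence holds for monoidal schemes in the setting of commutative monoids with absorbing element $0$, where spectra consist of the prime ideals that contain $0$. -/

import Mathlib

open CategoryTheory TopologicalSpace Opposite

universe u

noncomputable section

namespace MonoidalGeometry

/-- A prime ideal of a commutative monoid `M`: a subset stable under multiplication by `M` whose
complement is a submonoid. The empty set is allowed. -/
@[ext]
structure PrimeIdeal (M : Type u) [CommMonoid M] where
  /-- The underlying set of the ideal. -/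
  carrier : Set M
  mul_mem : ∀ (a : M) {b : M}, b ∈ carrier → a * b ∈ carrier
  one_notMem : (1 : M) ∉ carrier
  mem_or_mem : ∀ {a b : M}, a * b ∈ carrier → a ∈ carrier ∨ b ∈ carrier

section Affine

variable (M : Type u) [CommMonoid M]

/-- The complement of a prime ideal, as a submonoid. -/
def PrimeIdeal.compl {M : Type u} [CommMonoid M] (p : PrimeIdeal M) : Submonoid M where
  carrier := p.carrierᶜ
  one_mem' := p.one_notMem
  mul_mem' ha hb h := (p.mem_or_mem h).elim ha hb

/-- The set of prime ideals of `M` that contain the set `I`. The two cases used below are `I = ∅`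
(all prime ideals of a commutative monoid) and `I = {0}` (the prime ideals of a commutative monoid
with absorbing element, where every ideal has to contain the absorbing element). -/
def PrimesOver (I : Set M) : Type u := {p : PrimeIdeal M // I ⊆ p.carrier}

/-- The Zariski topology: the closed sets are the sets `V(a)` of primes containing a subset `a`,
so that the open sets are the sets of primes that do not contain `a`. -/
instance PrimesOver.topology (I : Set M) : TopologicalSpace (PrimesOver M I) where
  IsOpen U := ∃ a : Set M, U = {p | ¬ a ⊆ p.1.carrier}
  isOpen_univ := ⟨{1}, by
    ext p
    simpa using p.1.one_notMem⟩
  isOpen_inter := by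
    rintro _ _ ⟨a, rfl⟩ ⟨b, rfl⟩
    refine ⟨Set.image2 (· * ·) a b, ?_⟩
    ext p
    simp only [Set.mem_inter_iff, Set.mem_ofPred_eq, Set.not_subset]
    constructor
    · rintro ⟨⟨f, hf, hfp⟩, ⟨g, hg, hgp⟩⟩
      exact ⟨f * g, ⟨f, hf, g, hg, rfl⟩, fun h => (p.1.mem_or_mem h).elim hfp hgp⟩
    · rintro ⟨_, ⟨f, hf, g, hg, rfl⟩, h⟩
      exact ⟨⟨f, hf, fun hfp => h (by
        have := p.1.mul_mem g hfp
        rwa [mul_comm] at this)⟩, ⟨g, hg, fun hgp => h (p.1.mul_mem f hgp)⟩⟩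
  isOpen_sUnion := by
    intro S hS
    refine ⟨{f | ∃ a : Set M, {p : PrimesOver M I | ¬ a ⊆ p.1.carrier} ∈ S ∧ f ∈ a}, ?_⟩
    ext p
    rw [Set.mem_sUnion, Set.mem_ofPred_eq, Set.not_subset]
    constructor
    · rintro ⟨U, hU, hp⟩
      obtain ⟨a, rfl⟩ := hS U hU
      obtain ⟨f, hf, hfp⟩ := Set.not_subset.mp hp
      exact ⟨f, ⟨a, hU, hf⟩, hfp⟩
    · rintro ⟨f, ⟨a, ha, hf⟩, hfp⟩
      exact ⟨_, ha, Set.not_subset.mpr ⟨f, hf, hfp⟩⟩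

/-- The topological space of `PrimesOver M I`. -/
def primesTop (I : Set M) : TopCat.{u} := TopCat.of (PrimesOver M I)

/-- The localization `M_p` of `M` at the prime ideal `p`, that is, at its complement. -/
abbrev localizationAt (I : Set M) (p : primesTop M I) : Type u :=
  Localization (PrimeIdeal.compl (Subtype.val p : PrimeIdeal M))

/-- The predicate on families `s(p) ∈ M_p`, `p ∈ U`, that there are `a b : M` with `b ∉ p` and
`s(p) = a / b` for all `p ∈ U`. -/
def isFractionPrelocal (I : Set M) : TopCat.PrelocalPredicate (localizationAt M I) where
  pred {U} s := ∃ a b : M, ∀ p : U, ∃ hb : b ∈ (p.1.1 : PrimeIdeal M).compl,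
    s p = Localization.mk a ⟨b, hb⟩
  res := by
    rintro U V i s ⟨a, b, h⟩
    exact ⟨a, b, fun p => h (i p)⟩

/-- The predicate of being locally a fraction. -/
def isLocallyFraction (I : Set M) : TopCat.LocalPredicate (localizationAt M I) :=
  (isFractionPrelocal M I).sheafify

/-- The families that are locally fractions form a submonoid. -/
def sectionsSubmonoid (I : Set M) (U : Opens (primesTop M I)) :
    Submonoid (∀ p : U, localizationAt M I p.1) where
  carrier := {s | (isLocallyFraction M I).pred s}
  one_mem' := fun p => ⟨U, p.2, 𝟙 U, 1, 1, fun q =>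
    ⟨Submonoid.one_mem _, (Localization.mk_one).symm⟩⟩
  mul_mem' := by
    intro s t hs ht p
    obtain ⟨V, hV, i, a, b, h⟩ := hs p
    obtain ⟨W, hW, j, c, d, k⟩ := ht p
    refine ⟨V ⊓ W, ⟨hV, hW⟩, Opens.infLELeft V W ≫ i, a * c, b * d, fun q => ?_⟩
    obtain ⟨hb, h'⟩ := h ⟨q.1, q.2.1⟩
    obtain ⟨hd, k'⟩ := k ⟨q.1, q.2.2⟩
    refine ⟨Submonoid.mul_mem _ hb hd, ?_⟩
    have : s ⟨q.1, i.le q.2.1⟩ * t ⟨q.1, j.le q.2.2⟩ =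
        Localization.mk (a * c) (⟨b, hb⟩ * ⟨d, hd⟩) := by
      rw [← Localization.mk_mul]
      exact congrArg₂ (· * ·) h' k'
    exact this

/-- The structure presheaf, with values in commutative monoids: its sections over `U` are the
families `s(p) ∈ M_p`, `p ∈ U`, that are locally fractions. -/
def structurePresheaf (I : Set M) : TopCat.Presheaf CommMonCat.{u} (primesTop M I) where
  obj U := CommMonCat.of (sectionsSubmonoid M I U.unop)
  map {U V} i := CommMonCat.ofHom
    { toFun := fun s => ⟨fun p => s.1 (i.unop p), (isLocallyFraction M I).res i.unop s.1 s.2⟩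
      map_one' := rfl
      map_mul' := fun _ _ => rfl }

theorem structurePresheaf_isSheaf (I : Set M) : (structurePresheaf M I).IsSheaf :=
  (TopCat.Presheaf.isSheaf_iff_isSheaf_comp (forget CommMonCat.{u}) _).mpr
    (TopCat.Presheaf.isSheaf_of_iso
      (NatIso.ofComponents (fun _ => Iso.refl _) :
        (TopCat.subsheafToTypes (isLocallyFraction M I)).1 ≅
          structurePresheaf M I ⋙ forget CommMonCat.{u})
      (TopCat.subsheafToTypes (isLocallyFraction M I)).2)

end Affine

/-- A monoidal space: a topological space with a sheaf of commutative monoids. -/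
abbrev MonoidalSpace : Type (u + 1) := AlgebraicGeometry.SheafedSpace.{u + 1, u, u} CommMonCat.{u}

/-- The space of primes of `M` containing `I` with its structure sheaf. -/
def primesSpace (M : Type u) [CommMonoid M] (I : Set M) : MonoidalSpace.{u} where
  carrier := primesTop M I
  presheaf := structurePresheaf M I
  IsSheaf := structurePresheaf_isSheaf M I

/-- The spectrum of a commutative monoid: all its prime ideals (the empty one included). -/
def Spec (M : Type u) [CommMonoid M] : MonoidalSpace.{u} := primesSpace M ∅

/-- The spectrum of a commutative monoid with absorbing element `0`: the prime ideals
that contain `0`. -/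
def SpecZero (A : Type u) [CommMonoidWithZero A] : MonoidalSpace.{u} := primesSpace A {0}

/-- A commutative monoid is noetherian if its congruences satisfy the ascending chain condition. -/
def IsNoetherianMonoid (M : Type u) [CommMonoid M] : Prop := WellFoundedGT (Con M)

namespace MonoidalSpace

variable (X : MonoidalSpace.{u})

/-- The open subspace of `X` on the open set `U`. -/
abbrev openSubspace (U : Opens X) : MonoidalSpace.{u} := X.restrict U.isOpenEmbedding

/-- The stalk of the structure sheaf at `x`: the filtered colimit of the monoids of sections over
the open neighbourhoods of `x`. -/
def stalk (x : X) : CommMonCat.{u} :=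
  CommMonCat.FilteredColimits.colimit.{u, u} ((OpenNhds.inclusion x).op ⋙ X.presheaf)

/-- The open set `U` is isomorphic to the spectrum of the commutative monoid `M`. -/
def IsSpecOn (U : Opens X) (M : Type u) [CommMonoid M] : Prop :=
  Nonempty (openSubspace X U ≅ Spec M)

/-- The open set `U` is isomorphic to the spectrum of the commutative monoid with absorbing
element `A`. (An isomorphism of monoids preserves absorbing elements, so nothing has to
be added about these.) -/
def IsSpecZeroOn (U : Opens X) (A : Type u) [CommMonoidWithZero A] : Prop :=
  Nonempty (openSubspace X U ≅ SpecZero A)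

/-- Monoidal schemes: monoidal spaces locally isomorphic to spectra of commutative monoids. -/
def IsMonoidalScheme : Prop :=
  ∀ x : X, ∃ U : Opens X, x ∈ U ∧ ∃ (M : Type u) (_ : CommMonoid M), IsSpecOn X U M

/-- A monoidal scheme is noetherian if it has a finite open cover by spectra of noetherian
monoids. -/
def IsNoetherian : Prop :=
  ∃ (n : ℕ) (U : Fin n → Opens X), (⨆ i, U i) = ⊤ ∧
    ∀ i, ∃ (M : Type u) (_ : CommMonoid M), IsNoetherianMonoid M ∧ IsSpecOn X (U i) M

/-- Monoidal schemes with absorbing elements: monoidal spaces locally isomorphic to spectra of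
commutative monoids with absorbing element. -/
def IsMonoidalSchemeWithZero : Prop :=
  ∀ x : X, ∃ U : Opens X, x ∈ U ∧ ∃ (A : Type u) (_ : CommMonoidWithZero A), IsSpecZeroOn X U A

/-- Such a scheme is noetherian if it has a finite open cover by spectra of noetherian
monoids with absorbing element. -/
def IsNoetherianWithZero : Prop :=
  ∃ (n : ℕ) (U : Fin n → Opens X), (⨆ i, U i) = ⊤ ∧
    ∀ i, ∃ (A : Type u) (_ : CommMonoidWithZero A), IsNoetherianMonoid A ∧ IsSpecZeroOn X (U i) A

/-- `X` is torsion-free if the unit group of every stalk is a torsion-free abelian group. -/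
def IsTorsionFree : Prop := ∀ x : X, IsMulTorsionFree (stalk X x)ˣ

/-- For every point `x` there is a polynomial `P` (depending on `x` only) such that every finite
abelian group `G` of order `n` receives exactly `P(n)` homomorphisms from the unit
group of the stalk at `x`. -/
def HasPolynomialHomCount : Prop :=
  ∀ x : X, ∃ P : Polynomial ℚ, ∀ (G : Type) [CommGroup G] [Finite G],
    Finite ((stalk X x)ˣ →* G) ∧ (Nat.card ((stalk X x)ˣ →* G) : ℚ) = P.eval (Nat.card G : ℚ)

end MonoidalSpace

end MonoidalGeometry

end

/-!
Every condition in the theorem concerns a single unit group `A = 𝒪_{X,x}ˣ`, and noetherianity enters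
only through the fact that `A` is finitely generated.

If `U` is an open neighbourhood of `x` isomorphic to the spectrum of a noetherian monoid `M`, and
`p` is the prime corresponding to `x`, then evaluating sections at `p` defines a homomorphism
`𝒪_{X,x} → M_p`, which is injective because two fractions that agree at `p` agree on a
neighbourhood of `p` (`stalkEval_injective`). So `A` embeds into the units of `M_p`. A subgroup `H`
of such a group yields the congruence on `M` relating `a` to `b` when they differ in `M_p` by an
element of `H`, and `H` can be recovered from it because each unit of `M_p` is a fraction. The
ascending chain condition thus passes from the congruences of `M` to the subgroups of `A`
(`wellFoundedGT_subgroup_of_injective_localization`), and `A` is finitely generated. This avoids the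
theorem that noetherian commutative monoids are finitely generated. The argument is the same for
primes containing a prescribed set, hence in the setting with an absorbing element.

A finitely generated abelian group is `ℤ^r × T` with `T` finite, and
`#Hom(A, G) = (#G)^r * #Hom(T, G)`. If `A` is torsion-free, then `T` is trivial and the polynomial is
`X ^ r`. Conversely, groups of prime order `q > #T` receive only the trivial homomorphism from `T`,
so that the polynomial has to be `X ^ r`; testing it on `G = T` shows that `T` has only one
endomorphism, that is, `T` is trivial (`isMulTorsionFree_iff_exists_polynomial_card_hom`).
-/

/-! ### Counting homomorphisms from a finitely generated abelian group -/

theorem Group.fg_of_wellFoundedGT_subgroup {A : Type*} [CommGroup A] [WellFoundedGT (Subgroup A)] :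
    Group.FG A := by
  have : WellFoundedGT (Submodule ℤ (Additive A)) :=
    (Subgroup.toAddSubgroup.trans
      (AddSubgroup.toIntSubmodule (M := Additive A))).symm.strictMono.wellFoundedGT
  have : IsNoetherian ℤ (Additive A) := isNoetherian_iff'.mpr this
  have : AddGroup.FG (Additive A) := Module.Finite.iff_addGroup_fg.mp inferInstance
  exact GroupFG.iff_add_fg.mpr this

namespace MonoidalGeometry

/-- Homomorphisms from a free abelian group of finite rank times `T` to `G`: the images of a basis
may be chosen freely. -/
def homFreeProdEquiv (J : Type*) [Fintype J] [DecidableEq J] (T G : Type*) [CommGroup T]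
    [CommGroup G] :
    ((J → Multiplicative ℤ) × T →* G) ≃ (J → G) × (T →* G) :=
  Equiv.trans
    { toFun := fun f => (f.comp (MonoidHom.inl _ _), f.comp (MonoidHom.inr _ _))
      invFun := fun g => g.1.coprod g.2
      left_inv := MonoidHom.coprod_unique
      right_inv := fun _ =>
        Prod.ext (MonoidHom.coprod_comp_inl _ _) (MonoidHom.coprod_comp_inr _ _) }
    (Equiv.prodCongr
      ((Pi.monoidHomMulEquiv (fun _ : J => Multiplicative ℤ) G).toEquiv.trans
        (Equiv.piCongrRight fun _ => (zpowersHom G).symm))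
      (Equiv.refl _))

theorem isMulTorsionFree_iff_exists_polynomial_card_hom (A : Type u) [CommGroup A] [Group.FG A] :
    IsMulTorsionFree A ↔ ∃ P : Polynomial ℚ, ∀ (G : Type) [CommGroup G] [Finite G],
      Finite (A →* G) ∧ (Nat.card (A →* G) : ℚ) = P.eval (Nat.card G : ℚ) := by
  classical
  obtain ⟨ι, J, _, _, p, hp, e, ⟨φ⟩⟩ := CommGroup.equiv_free_prod_prod_multiplicative_zmod A
  have (i : ι) : NeZero (p i ^ e i) := ⟨pow_ne_zero _ (hp i).ne_zero⟩
  set T := (i : ι) → Multiplicative (ZMod (p i ^ e i))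
  have homEquiv (G : Type) [CommGroup G] : (A →* G) ≃ (J → G) × (T →* G) :=
    φ.monoidHomCongrLeftEquiv.trans (homFreeProdEquiv J T G)
  have card_hom (G : Type) [CommGroup G] [Finite G] :
      Finite (A →* G) ∧
        Nat.card (A →* G) = Nat.card G ^ Fintype.card J * Nat.card (T →* G) := by
    have : Finite (T →* G) := Finite.of_injective _ DFunLike.coe_injective
    refine ⟨.of_equiv _ (homEquiv G).symm, ?_⟩
    rw [Nat.card_congr (homEquiv G), Nat.card_prod, Nat.card_fun, Nat.card_eq_fintype_card (α := J)]
  constructor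
  · intro _
    have : IsMulTorsionFree T :=
      Function.Injective.isMulTorsionFree (φ.symm.toMonoidHom.comp (MonoidHom.inr _ T))
        (φ.symm.injective.comp (Prod.mk_right_injective 1))
    have : Subsingleton T := by
      refine subsingleton_of_forall_eq 1 fun t => ?_
      exact (isOfFinOrder_of_finite t).eq_one'
    refine ⟨Polynomial.X ^ Fintype.card J, fun G _ _ => ⟨(card_hom G).1, ?_⟩⟩
    have : Subsingleton (T →* G) :=
      subsingleton_of_forall_eq 1 fun f => MonoidHom.ext fun t => by
        rw [Subsingleton.elim t 1, map_one, map_one]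
    rw [(card_hom G).2]
    simp
  · rintro ⟨P, hP⟩
    have eval_card (G : Type) [CommGroup G] [Finite G] :
        P.eval (Nat.card G : ℚ) = (Nat.card G : ℚ) ^ Fintype.card J * Nat.card (T →* G) := by
      rw [← (hP G).2, (card_hom G).2]
      push_cast
      rfl
    -- A group of prime order not dividing `#T` receives only the trivial homomorphism from `T`.
    have eval_prime (q : ℕ) (hq : q.Prime) (hqT : Nat.card T < q) :
        P.eval (q : ℚ) = (Polynomial.X ^ Fintype.card J : Polynomial ℚ).eval (q : ℚ) := by
      have : NeZero q := ⟨hq.ne_zero⟩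
      have : Subsingleton (T →* Multiplicative (ZMod q)) := by
        refine subsingleton_of_forall_eq 1 fun f => MonoidHom.ext fun t => ?_
        have hcop : (Nat.card T).Coprime q :=
          (Nat.coprime_of_lt_prime Nat.card_pos.ne' hqT hq).symm
        have h1 : orderOf (f t) ∣ Nat.card T := (orderOf_map_dvd f t).trans (orderOf_dvd_natCard t)
        have h2 : orderOf (f t) ∣ q := by
          simpa using orderOf_dvd_natCard (f t)
        exact orderOf_eq_one_iff.mp (Nat.eq_one_of_dvd_coprimes hcop h1 h2)
      have := eval_card (Multiplicative (ZMod q))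
      simpa using this
    have hPX : P = Polynomial.X ^ Fintype.card J := by
      refine Polynomial.eq_of_infinite_eval_eq _ _ ?_
      refine ((Nat.infinite_setOfPred_prime.sdiff (Set.finite_Iic (Nat.card T))).image
        Nat.cast_injective.injOn).mono ?_
      rintro _ ⟨q, ⟨hq, hqT⟩, rfl⟩
      exact eval_prime q hq (not_le.mp hqT)
    -- Testing against `G = T` compares the identity of `T` with the trivial endomorphism. This is
    -- possible because `T` is a product of groups `ZMod n`, hence a type in universe `0`.
    have hcard : Nat.card (T →* T) = 1 := by
      have h := eval_card T
      rw [hPX, Polynomial.eval_pow, Polynomial.eval_X] at h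
      have h0 : (Nat.card T : ℚ) ^ Fintype.card J ≠ 0 := by simp
      exact_mod_cast (mul_eq_left₀ h0).mp h.symm
    have : Subsingleton (T →* T) := (Nat.card_eq_one_iff_unique.mp hcard).1
    have : Subsingleton T := subsingleton_of_forall_eq 1 fun t =>
      DFunLike.congr_fun (Subsingleton.elim (MonoidHom.id T) 1) t
    exact Function.Injective.isMulTorsionFree φ.toMonoidHom φ.injective

/-! ### Units of localizations of noetherian monoids -/

/-- If the congruences of `M` satisfy the ascending chain condition, then so do the subgroups of
every group that embeds into a localization of `M`. -/
theorem wellFoundedGT_subgroup_of_injective_localization {M A : Type*} [CommMonoid M] [CommGroup A]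
    [WellFoundedGT (Con M)] {S : Submonoid M} (f : A →* Localization S)
    (hf : Function.Injective f) : WellFoundedGT (Subgroup A) := by
  let ι : M →* Localization S := (Localization.monoidOf S).toMonoidHom
  -- Elements of `M` are related if their images in the localization differ by an element of `H`.
  let c (H : Subgroup A) : Con M :=
    { r := fun a b => ∃ h ∈ H, f h * ι a = ι b
      iseqv :=
        { refl := fun a => ⟨1, H.one_mem, by simp⟩
          symm := by
            rintro a b ⟨h, hH, hab⟩
            refine ⟨h⁻¹, H.inv_mem hH, ?_⟩
            rw [← hab, ← mul_assoc, ← map_mul, inv_mul_cancel, map_one, one_mul]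
          trans := by
            rintro a b d ⟨h, hH, hab⟩ ⟨k, hK, hbd⟩
            refine ⟨k * h, H.mul_mem hK hH, ?_⟩
            rw [map_mul, mul_assoc, hab, hbd] }
      mul' := by
        rintro a b a' b' ⟨h, hH, hab⟩ ⟨k, hK, hbd⟩
        refine ⟨h * k, H.mul_mem hH hK, ?_⟩
        rw [map_mul, map_mul, map_mul, mul_mul_mul_comm, hab, hbd] }
  have hmono : Monotone c := fun H K hHK a b ⟨h, hH, hab⟩ => ⟨h, hHK hH, hab⟩
  have hinj : Function.Injective c := by
    -- `H` consists of the `h` such that `s` is related to `a`, where `f h = a / s`.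
    have key (H K : Subgroup A) (hHK : c H = c K) : H ≤ K := by
      intro h hH
      obtain ⟨a, s, hs⟩ : ∃ (a : M) (s : S), f h * ι s = ι a := by
        obtain ⟨⟨a, s⟩, hs⟩ := (Localization.monoidOf S).surj (f h)
        exact ⟨a, s, hs⟩
      have hrel : c K s a := hHK ▸ (⟨h, hH, hs⟩ : c H s a)
      obtain ⟨k, hK, hk⟩ := hrel
      have hunit : IsUnit (ι s) := (Localization.monoidOf S).map_units s
      have : f k = f h := hunit.mul_right_cancel (hk.trans hs.symm)
      exact hf this ▸ hK
    exact fun H K hHK => le_antisymm (key H K hHK) (key K H hHK.symm)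
  exact (hmono.strictMono_of_injective hinj).wellFoundedGT

/-! ### Stalks of monoidal schemes -/

section

variable {M : Type u} [CommMonoid M] {I : Set M}

/-- Sections that agree at a point agree near that point. -/
theorem exists_open_eq_of_apply_eq {U : Opens (primesTop M I)}
    (s t : sectionsSubmonoid M I U) (p : U) (h : s.1 p = t.1 p) :
    ∃ W : Opens (primesTop M I), p.1 ∈ W ∧ ∃ hWU : W ≤ U,
      ∀ (q : primesTop M I) (hq : q ∈ W), s.1 ⟨q, hWU hq⟩ = t.1 ⟨q, hWU hq⟩ := by
  obtain ⟨V, hV, i, a, b, hs⟩ := s.2 p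
  obtain ⟨V', hV', j, a', b', ht⟩ := t.2 p
  obtain ⟨hb, hsp⟩ := hs ⟨p.1, hV⟩
  obtain ⟨hb', htp⟩ := ht ⟨p.1, hV'⟩
  have heq : Localization.mk a ⟨b, hb⟩ = Localization.mk a' ⟨b', hb'⟩ :=
    hsp.symm.trans (h.trans htp)
  obtain ⟨e, he⟩ := Localization.r_iff_exists.mp (Localization.mk_eq_mk_iff.mp heq)
  -- The open set of primes that do not contain `e`.
  let D : Opens (primesTop M I) := ⟨{q | ¬ ({e.1} : Set M) ⊆ q.1.carrier}, {e.1}, rfl⟩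
  refine ⟨V ⊓ V' ⊓ D, ⟨⟨hV, hV'⟩, fun hD => e.2 (hD rfl)⟩,
    fun q hq => i.le hq.1.1, fun q hq => ?_⟩
  obtain ⟨hqb, hsq⟩ := hs ⟨q, hq.1.1⟩
  obtain ⟨hqb', htq⟩ := ht ⟨q, hq.1.2⟩
  refine Eq.trans hsq (Eq.trans ?_ htq.symm)
  have hqe : e.1 ∈ q.1.compl := fun hmem => hq.2 (Set.singleton_subset_iff.mpr hmem)
  exact Localization.mk_eq_mk_iff.mpr (Localization.r_iff_exists.mpr ⟨⟨e.1, hqe⟩, he⟩)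

/-- Evaluation of sections at the point `p`. -/
def evalAt {U : Opens (primesTop M I)} (p : U) :
    sectionsSubmonoid M I U →* localizationAt M I p.1 :=
  (Pi.evalMonoidHom _ p).comp (Submonoid.subtype _)

variable {X : MonoidalSpace.{u}} (φ : primesSpace M I ⟶ X) (p : primesTop M I)

/-- For a morphism `φ` from a spectrum to `X` and a prime `p`, pulling back sections near `φ p` and
evaluating them at `p`, as a cocone over the diagram that defines the stalk at `φ p`. -/
noncomputable def stalkCocone :
    Limits.Cocone ((OpenNhds.inclusion (φ.hom.base p)).op ⋙ X.presheaf) where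
  pt := CommMonCat.of (localizationAt M I p)
  ι :=
    { app := fun V => φ.hom.c.app (op V.unop.1) ≫
        CommMonCat.ofHom (evalAt ⟨p, V.unop.2⟩)
      naturality := by
        intro V W i
        have h := φ.hom.c.naturality ((OpenNhds.inclusion (φ.hom.base p)).op.map i)
        refine (reassoc_of% h) _ |>.trans ?_
        rfl }

/-- The homomorphism from the stalk at `φ p` to `M_p` that evaluates the pullback of a germ at
`p`. -/
noncomputable def stalkEval : MonoidalSpace.stalk X (φ.hom.base p) →* localizationAt M I p :=
  ((CommMonCat.FilteredColimits.colimitCoconeIsColimit _).desc (stalkCocone φ p)).hom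

theorem stalkEval_ι (V : OpenNhds (φ.hom.base p)) (s : X.presheaf.obj (op V.1)) :
    stalkEval φ p (((CommMonCat.FilteredColimits.colimitCocone
      ((OpenNhds.inclusion (φ.hom.base p)).op ⋙ X.presheaf)).ι.app (op V)).hom s) =
      ((φ.hom.c.app (op V.1)).hom s).1 ⟨p, V.2⟩ :=
  ConcreteCategory.congr_hom ((CommMonCat.FilteredColimits.colimitCoconeIsColimit _).fac
    (stalkCocone φ p) (op V)) s

/-- Two germs at `x` are represented by sections over a common neighbourhood. -/
theorem exists_rep_pair (x : X) (s t : MonoidalSpace.stalk X x) :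
    ∃ (V : OpenNhds x) (s' t' : X.presheaf.obj (op V.1)),
      ((CommMonCat.FilteredColimits.colimitCocone
        ((OpenNhds.inclusion x).op ⋙ X.presheaf)).ι.app (op V)).hom s' = s ∧
      ((CommMonCat.FilteredColimits.colimitCocone
        ((OpenNhds.inclusion x).op ⋙ X.presheaf)).ι.app (op V)).hom t' = t := by
  let F := (OpenNhds.inclusion x).op ⋙ X.presheaf
  let c := CommMonCat.FilteredColimits.colimitCocone F
  have hc : Limits.IsColimit c := CommMonCat.FilteredColimits.colimitCoconeIsColimit F
  obtain ⟨V, s, rfl⟩ := Limits.Concrete.isColimit_exists_rep F hc s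
  obtain ⟨W, t, rfl⟩ := Limits.Concrete.isColimit_exists_rep F hc t
  refine ⟨V.unop ⊓ W.unop, F.map (OpenNhds.infLELeft _ _).op s,
    F.map (OpenNhds.infLERight _ _).op t, ?_, ?_⟩
  · exact ConcreteCategory.congr_hom (c.w (OpenNhds.infLELeft _ _).op) s
  · exact ConcreteCategory.congr_hom (c.w (OpenNhds.infLERight _ _).op) t

theorem stalkEval_injective [H : AlgebraicGeometry.SheafedSpace.IsOpenImmersion φ] :
    Function.Injective (stalkEval φ p) := by
  intro s t hst
  obtain ⟨V, s, t, rfl, rfl⟩ := exists_rep_pair _ s t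
  rw [stalkEval_ι, stalkEval_ι] at hst
  -- The pullbacks agree near `p`, and `φ` identifies sections over the image of an open set with
  -- their pullbacks.
  obtain ⟨W, hpW, hWV, hW⟩ := exists_open_eq_of_apply_eq _ _ _ hst
  let F := (OpenNhds.inclusion (φ.hom.base p)).op ⋙ X.presheaf
  let c := CommMonCat.FilteredColimits.colimitCocone F
  let W' : OpenNhds (φ.hom.base p) := ⟨H.base_open.functor.obj W, ⟨p, hpW, rfl⟩⟩
  have hle : W' ≤ V := by
    rintro _ ⟨q, hq, rfl⟩
    exact hWV hq
  let i : W' ⟶ V := homOfLE hle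
  have hres : F.map i.op s = F.map i.op t := by
    have := H.c_iso W
    refine (ConcreteCategory.bijective_of_isIso (φ.hom.c.app (op W'.1))).1 ?_
    have hnat (r : X.presheaf.obj (op V.1)) :=
      ConcreteCategory.congr_hom (φ.hom.c.naturality ((OpenNhds.inclusion _).op.map i.op)) r
    refine (hnat s).trans (Eq.trans ?_ (hnat t).symm)
    refine Subtype.ext (funext fun ⟨q, hq⟩ => ?_)
    obtain ⟨q', hq', hqq⟩ := hq
    obtain rfl := H.base_open.injective hqq
    exact hW _ hq'
  have hcw (r : X.presheaf.obj (op V.1)) := ConcreteCategory.congr_hom (c.w i.op) r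
  exact (hcw s).symm.trans ((congrArg (c.ι.app (op W')).hom hres).trans (hcw t))

end

/-- The unit group of the stalk at a point with a noetherian affine neighbourhood is finitely
generated. -/
theorem fg_units_stalk_of_iso {X : MonoidalSpace.{u}} {U : Opens X} {x : X} (hx : x ∈ U)
    {M : Type u} [CommMonoid M] (hM : IsNoetherianMonoid M) {I : Set M}
    (e : MonoidalSpace.openSubspace X U ≅ primesSpace M I) :
    Group.FG (MonoidalSpace.stalk X x)ˣ := by
  let φ : primesSpace M I ⟶ X := e.inv ≫ X.ofRestrict U.isOpenEmbedding
  have hφ : φ.hom.base (e.hom.hom.base ⟨x, hx⟩) = x := by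
    have h : (e.hom ≫ φ).hom.base ⟨x, hx⟩ = x := by
      rw [Iso.hom_inv_id_assoc]
      rfl
    exact h
  generalize e.hom.hom.base ⟨x, hx⟩ = p at hφ
  subst hφ
  have : WellFoundedGT (Con M) := hM
  have : WellFoundedGT (Subgroup (MonoidalSpace.stalk X (φ.hom.base p))ˣ) :=
    wellFoundedGT_subgroup_of_injective_localization
      ((stalkEval φ p).comp (Units.coeHom _))
      ((stalkEval_injective φ p).comp Units.val_injective)
  exact Group.fg_of_wellFoundedGT_subgroup

theorem isTorsionFree_iff_hasPolynomialHomCount {X : MonoidalSpace.{u}}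
    (hX : ∀ x : X, Group.FG (MonoidalSpace.stalk X x)ˣ) :
    MonoidalSpace.IsTorsionFree X ↔ MonoidalSpace.HasPolynomialHomCount X :=
  forall_congr' fun x =>
    have := hX x
    isMulTorsionFree_iff_exists_polynomial_card_hom _

end MonoidalGeometry

theorem mainTheorem11 :
    (∀ X : MonoidalGeometry.MonoidalSpace.{u},
      MonoidalGeometry.MonoidalSpace.IsMonoidalScheme X →
      MonoidalGeometry.MonoidalSpace.IsNoetherian X →
      (MonoidalGeometry.MonoidalSpace.IsTorsionFree X ↔
        MonoidalGeometry.MonoidalSpace.HasPolynomialHomCount X)) ∧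
    (∀ X : MonoidalGeometry.MonoidalSpace.{u},
      MonoidalGeometry.MonoidalSpace.IsMonoidalSchemeWithZero X →
      MonoidalGeometry.MonoidalSpace.IsNoetherianWithZero X →
      (MonoidalGeometry.MonoidalSpace.IsTorsionFree X ↔
        MonoidalGeometry.MonoidalSpace.HasPolynomialHomCount X)) := by
  refine ⟨fun X _ hX => ?_, fun X _ hX => ?_⟩
  all_goals
    refine MonoidalGeometry.isTorsionFree_iff_hasPolynomialHomCount fun x => ?_
    obtain ⟨n, U, hU, h⟩ := hX
    obtain ⟨i, hx⟩ := Opens.mem_iSup.mp (hU ▸ Opens.mem_top x : x ∈ ⨆ i, U i)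
    obtain ⟨M, _, hM, ⟨e⟩⟩ := h i
    exact MonoidalGeometry.fg_units_stalk_of_iso hx hM e
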